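/- Let $T>0$, $X\in\mathbb R$, $\lambda\in\mathbb R$, and let $(\Omega,\mathcal F,(\mathcal F_t)_{t\ge0},\mathbb P)$ be a filtered probability space satisfying the usual conditions such that $\mathbb P[A]\in\{0,1\}$ for all $A\in\mathcal F_0$. Let $S^0=(S^0_t)_{t\ge 0}$ be any right-continuous martingale with $\mathbb E\big[(\sup_{0\le t\le T}|S^0_t|)^2\big]<\infty$, and let $S_0$ denote the ($\mathbb P$-a.s. constant) initial value $S^0_0$. Let $\mathcal X(T,X)$ be the class of all adapted processes $x=(x_t)_{0\le t\le T}$ with $\mathbb P$-a.s. absolutely continuous paths such that $x_0=X$ and $x_T=0$ $\mathbb P$-a.s. and $\mathbb E\big[\int_0^T\dot x_t^2\,dt\big]<\infty$. For every $\nu\ge0$ and $x\in\mathcal X(T,X)$ the cost $\mathbb E\big[\int_0^T(\dot x_t^2+\lambda S^0_tx_t+\nu^2x_t^2)\,dt\big]$ is well defined and finite. Moreover: (a) For $\nu>0$, the minimizer (unique up to indistinguishability on $[0,T]$) within $\mathcal X(T,X)$ of $$\mathbb E\Big[\int_0^T\big(\dot x_t^2+\lambda S^0_tx_t+\nu^2x_t^2\big)\,dt\Big]$$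 is $$x^*_t=\sinh(\nu(T-t))\Big[\frac{X}{\sinh(\nu T)}-\frac{\lambda}{2\nu}\int_0^t\frac{S^0_s}{1+\cosh(\nu(T-s))}\,ds\Big],\qquad 0\le t\le T,$$ and the minimal value is $$\nu X^2\coth(\nu T)+\frac{\lambda XS_0}{\nu}\tanh\Big(\frac{\nu T}{2}\Big)-\frac{\lambda^2}{4\nu^2}\,\mathbb E\Big[\int_0^T\Big(S^0_t\tanh\Big(\frac{\nu(T-t)}{2}\Big)\Big)^2dt\Big].$$ (b) For $\nu=0$, the minimizer (unique up to indistinguishability on $[0,T]$) within $\mathcal X(T,X)$ of $\mathbb E\big[\int_0^T(\dot x_t^2+\lambda S^0_tx_t)\,dt\big]$ is $$x^0_t=\frac{T-t}{T}\Big[X-\frac{\lambda T}{4}\int_0^tS^0_s\,ds\Big],\qquad 0\le t\le T,$$ and the minimal value is $$\frac{X^2}{T}+\frac{\lambda}{2}XS_0T-\frac{\lambda^2}{16}\,\mathbb E\Big[\int_0^T\big(S^0_t(T-t)\big)^2dt\Big].$$ The expectations in both value formulas are finite. -/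

import Mathlib

open MeasureTheory ProbabilityTheory Set Filter
open scoped NNReal ENNReal Topology

noncomputable section

/-- A filtered probability space satisfies the usual conditions: the filtration is
right-continuous, and `𝓕 0` contains every subset of a `P`-null set (`P` applied to an arbitrary
set is its outer measure). -/
structure UsualConditions {Ω : Type*} {m : MeasurableSpace Ω} (𝓕 : Filtration ℝ≥0 m)
    (P : Measure Ω) : Prop where
  rightCont : 𝓕.IsRightContinuous
  complete : ∀ A : Set Ω, P A = 0 → MeasurableSet[𝓕 0] A

/-- `𝓕 0` is `P`-trivial. -/
def TrivialAtZero {Ω : Type*} {m : MeasurableSpace Ω} (𝓕 : Filtration ℝ≥0 m)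
    (P : Measure Ω) : Prop :=
  ∀ A : Set Ω, MeasurableSet[𝓕 0] A → P A = 0 ∨ P A = 1

/-- Almost all paths of the process `S` are right-continuous. -/
def RightContinuousPaths {Ω : Type*} {m : MeasurableSpace Ω} (P : Measure Ω)
    (S : ℝ≥0 → Ω → ℝ) : Prop :=
  ∀ᵐ ω ∂P, ∀ t : ℝ≥0, ContinuousWithinAt (fun s => S s ω) (Ioi t) t

/-- `E[(sup_{0 ≤ t ≤ T} |S_t|)²] < ∞`. -/
def SquareIntegrableSup {Ω : Type*} {m : MeasurableSpace Ω} (P : Measure Ω) (T : ℝ)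
    (S : ℝ≥0 → Ω → ℝ) : Prop :=
  ∫⁻ ω, (⨆ t : ℝ≥0, ⨆ _ : (t : ℝ) ≤ T, ‖S t ω‖ₑ) ^ 2 ∂P < ∞

/-- The class `𝓧(T, X)` of admissible strategies. A strategy is a process indexed by real time, of
which only the times in `[0, T]` matter; path properties are understood almost surely. For an
absolutely continuous path the derivative exists at almost every time of `[0, T]`. -/
structure IsAdmissible {Ω : Type*} {m : MeasurableSpace Ω} (𝓕 : Filtration ℝ≥0 m)
    (P : Measure Ω) (T X : ℝ) (x : ℝ → Ω → ℝ) : Prop where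
  adapted : ∀ t : ℝ≥0, (t : ℝ) ≤ T → StronglyMeasurable[𝓕 t] (x t)
  absCont : ∀ᵐ ω ∂P, AbsolutelyContinuousOnInterval (fun t => x t ω) 0 T
  initial : ∀ᵐ ω ∂P, x 0 ω = X
  terminal : ∀ᵐ ω ∂P, x T ω = 0
  energy : ∫⁻ ω, (∫⁻ t in Ioc 0 T, ‖deriv (fun s => x s ω) t‖ₑ ^ 2) ∂P < ∞

/-- The running cost `ẋ_t² + lam S_t x_t + ν² x_t²`. -/
def runningCost {Ω : Type*} (S : ℝ≥0 → Ω → ℝ) (lam ν : ℝ) (x : ℝ → Ω → ℝ) (t : ℝ) (ω : Ω) : ℝ :=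
  deriv (fun s => x s ω) t ^ 2 + lam * S t.toNNReal ω * x t ω + ν ^ 2 * x t ω ^ 2

/-- `E[∫_0^T f_t dt]`. -/
def expectedIntegral {Ω : Type*} {m : MeasurableSpace Ω} (P : Measure Ω) (T : ℝ)
    (f : ℝ → Ω → ℝ) : ℝ :=
  ∫ ω, (∫ t in (0 : ℝ)..T, f t ω) ∂P

/-- `E[∫_0^T f_t dt]` is well defined and finite. -/
def HasFiniteExpectedIntegral {Ω : Type*} {m : MeasurableSpace Ω} (P : Measure Ω) (T : ℝ)
    (f : ℝ → Ω → ℝ) : Prop :=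
  (∀ᵐ ω ∂P, IntervalIntegrable (fun t => f t ω) volume 0 T) ∧
    Integrable (fun ω => ∫ t in (0 : ℝ)..T, f t ω) P

/-- The cost functional `E[∫_0^T (ẋ_t² + lam S_t x_t + ν² x_t²) dt]`. -/
def cost {Ω : Type*} {m : MeasurableSpace Ω} (P : Measure Ω) (T : ℝ) (S : ℝ≥0 → Ω → ℝ)
    (lam ν : ℝ) (x : ℝ → Ω → ℝ) : ℝ :=
  expectedIntegral P T (runningCost S lam ν x)

/-- `xs` is admissible, minimizes the cost functional over the admissible strategies, and every
admissible minimizer coincides with it on `[0, T]`, up to indistinguishability. -/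
def IsUniqueMinimizer {Ω : Type*} {m : MeasurableSpace Ω} (𝓕 : Filtration ℝ≥0 m)
    (P : Measure Ω) (T X : ℝ) (S : ℝ≥0 → Ω → ℝ) (lam ν : ℝ) (xs : ℝ → Ω → ℝ) : Prop :=
  IsAdmissible 𝓕 P T X xs ∧
  (∀ x, IsAdmissible 𝓕 P T X x → cost P T S lam ν xs ≤ cost P T S lam ν x) ∧
  ∀ x, IsAdmissible 𝓕 P T X x →
    (∀ y, IsAdmissible 𝓕 P T X y → cost P T S lam ν x ≤ cost P T S lam ν y) →
    ∀ᵐ ω ∂P, ∀ t ∈ Icc 0 T, x t ω = xs t ω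

/-- The strategy
`x*_t = sinh(ν(T-t)) [X / sinh(νT) - (lam / 2ν) ∫_0^t S_s / (1 + cosh(ν(T-s))) ds]`. -/
def optimalStrategy {Ω : Type*} (T X : ℝ) (S : ℝ≥0 → Ω → ℝ) (lam ν : ℝ) (t : ℝ) (ω : Ω) : ℝ :=
  Real.sinh (ν * (T - t)) *
    (X / Real.sinh (ν * T) -
      lam / (2 * ν) *
        ∫ s in (0 : ℝ)..t, S s.toNNReal ω / (1 + Real.cosh (ν * (T - s))))

/-- The strategy `x⁰_t = ((T-t)/T) [X - (lam T / 4) ∫_0^t S_s ds]`. -/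
def optimalStrategyZero {Ω : Type*} (T X : ℝ) (S : ℝ≥0 → Ω → ℝ) (lam : ℝ) (t : ℝ) (ω : Ω) : ℝ :=
  (T - t) / T * (X - lam * T / 4 * ∫ s in (0 : ℝ)..t, S s.toNNReal ω)

end

/-! The cost is a convex quadratic functional of the strategy. Once the first variation at a
candidate `x*` vanishes, the excess cost of any admissible `x` is exactly `E∫((ẋ - ẋ*)² + ν²(x -
x*)²)` (`cost_sub_cost_candidate`), which gives optimality and uniqueness together. The cases `ν >
0` and `ν = 0` are treated at once through functions with `σ' = -C`, `C' = -ν²σ`, and `θ = σ/(1 +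
C)`, for which `θ' = -1/(1 + C)`. The candidate is `x* = σA` with `A' = -(lam/2) S/(1 + C)`.

The paths of `S` need not be differentiable, so nothing is integrated by parts against them.
Instead, `E∫ S y = E[S_T ∫ y]` for adapted square-integrable `y`
(`MeasureTheory.Martingale.integral_spaceTime_mul`): if `∫ y` is almost surely a constant `c`, then
`E∫ S y = c E[S_T]`. For a perturbation `h` vanishing at both ends, adding `lam S (θh)'` to the
first variation therefore changes nothing, and turns it into the exact derivative `-2(CAh)'`, whose
integral is zero (`integral_firstVariation`). Likewise the optimal running cost equals `-(σCA²)' -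
lam S (σθA)' - (lam²/4)(θS)²`, which yields the minimal value (`cost_candidate`); triviality of `𝓕
0` identifies `E[S_T]` with `S_0`.

The martingale identity needs adapted, jointly measurable integrands. Grid approximation from the
right supplies joint measurability, left difference quotients supply an adapted velocity
(`IsAdmissible.exists_isVelocity`), and the usual conditions absorb null sets. -/

noncomputable section

/-! ### Time grids approached from the right -/

/-- The nodes `(k + 1) / (n + 1)` of the grid of mesh `1 / (n + 1)`, clamped to
`[0, T]`. -/
def gridNode (T : ℝ) (n : ℕ) (k : ℤ) : ℝ := max 0 (min ((k + 1) / (n + 1)) T)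

lemma gridNode_mem {T : ℝ} (hT : 0 ≤ T) (n : ℕ) (k : ℤ) : gridNode T n k ∈ Icc 0 T :=
  ⟨le_max_left _ _, max_le hT (min_le_right _ _)⟩

lemma gridNode_floor_right {T : ℝ} (hT : 0 ≤ T) (n : ℕ) : gridNode T n ⌊(n + 1) * T⌋ = T := by
  have h : T ≤ (⌊((n : ℝ) + 1) * T⌋ + 1) / ((n : ℝ) + 1) := by
    rw [le_div_iff₀ (by positivity), mul_comm]
    exact (Int.lt_floor_add_one _).le
  rw [gridNode, min_eq_right h, max_eq_right hT]

lemma tendsto_gridNode_floor {T t : ℝ} (ht : 0 ≤ t) (htT : t < T) :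
    Tendsto (fun n : ℕ => gridNode T n ⌊(n + 1) * t⌋) atTop (𝓝[>] t) := by
  have hl : ∀ n : ℕ, t < (⌊((n : ℝ) + 1) * t⌋ + 1) / ((n : ℝ) + 1) := fun n => by
    rw [lt_div_iff₀ (by positivity), mul_comm]
    exact Int.lt_floor_add_one _
  have hu : ∀ n : ℕ, (⌊((n : ℝ) + 1) * t⌋ + 1) / ((n : ℝ) + 1) ≤ t + 1 / ((n : ℝ) + 1) := by
    intro n
    rw [add_div]
    gcongr
    rw [div_le_iff₀ (by positivity), mul_comm t]
    exact Int.floor_le _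
  refine tendsto_nhdsWithin_iff.2 ⟨?_, Eventually.of_forall fun n => ?_⟩
  · refine tendsto_of_tendsto_of_tendsto_of_le_of_le (g := fun _ => t)
      (h := fun n : ℕ => t + 1 / ((n : ℝ) + 1)) tendsto_const_nhds ?_ (fun n => ?_) (fun n => ?_)
    · simpa using tendsto_const_nhds.add (tendsto_one_div_add_atTop_nhds_zero_nat (𝕜 := ℝ))
    · exact le_max_of_le_right (le_min (hl n).le htT.le)
    · refine max_le (by positivity) ((min_le_left _ _).trans (hu n))
  · exact lt_max_of_lt_right (lt_min (hl n) htT)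

/-! ### Joint measurability and expected time integrals -/

section Joint

variable {Ω : Type*} {m : MeasurableSpace Ω} {P : Measure Ω} {T : ℝ}

/-- The product of `P` with Lebesgue measure on `[0, T]`. -/
abbrev spaceTime (P : Measure Ω) (T : ℝ) : Measure (Ω × ℝ) :=
  P.prod (volume.restrict (Ioc 0 T))

lemma ae_spaceTime_of_ae_forall [SFinite P] {p : Ω → ℝ → Prop}
    (h : ∀ᵐ ω ∂P, ∀ t ∈ Ioc 0 T, p ω t) : ∀ᵐ q ∂spaceTime P T, p q.1 q.2 := by
  have h1 := (Measure.quasiMeasurePreserving_fst (μ := P)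
    (ν := volume.restrict (Ioc 0 T))).ae h
  have h2 := (Measure.quasiMeasurePreserving_snd (μ := P)
    (ν := volume.restrict (Ioc 0 T))).ae (ae_restrict_mem measurableSet_Ioc)
  filter_upwards [h1, h2] with q hq1 hq2 using hq1 _ hq2

/-- A process with right-continuous paths is jointly measurable. -/
lemma aestronglyMeasurable_uncurry_of_rightContinuous [SFinite P] (hT : 0 ≤ T) {Y : ℝ → Ω → ℝ}
    (hY : ∀ t ∈ Icc 0 T, Measurable (Y t))
    (hrc : ∀ᵐ ω ∂P, ∀ t ∈ Ico 0 T, Tendsto (fun s => Y s ω) (𝓝[Ioc t T] t) (𝓝 (Y t ω))) :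
    AEStronglyMeasurable (fun q : Ω × ℝ => Y q.2 q.1) (spaceTime P T) := by
  -- Through the floor, the sampled process depends on time only via an integer, so countably many
  -- measurable variables determine it.
  have hmeas : ∀ n : ℕ, Measurable
      (fun q : Ω × ℝ => Y (gridNode T n ⌊((n : ℝ) + 1) * q.2⌋) q.1) := by
    intro n
    have h1 : Measurable (fun q : Ω × ℤ => Y (gridNode T n q.2) q.1) :=
      measurable_from_prod_countable_left fun k => hY _ (gridNode_mem hT n k)
    have h2 : Measurable (fun q : Ω × ℝ => (q.1, ⌊((n : ℝ) + 1) * q.2⌋)) := by fun_prop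
    exact h1.comp h2
  refine aestronglyMeasurable_of_tendsto_ae atTop (fun n => (hmeas n).aestronglyMeasurable)
    (ae_spaceTime_of_ae_forall
      (p := fun ω t => Tendsto (fun n : ℕ => Y (gridNode T n ⌊((n : ℝ) + 1) * t⌋) ω) atTop
        (𝓝 (Y t ω))) ?_)
  filter_upwards [hrc] with ω hω t ht
  rcases ht.2.eq_or_lt with rfl | hlt
  · simp [gridNode_floor_right hT]
  · refine (hω t ⟨ht.1.le, hlt⟩).comp (tendsto_nhdsWithin_iff.2 ⟨?_, ?_⟩)
    · exact (tendsto_gridNode_floor ht.1.le hlt).mono_right nhdsWithin_le_nhds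
    · filter_upwards [(tendsto_nhdsWithin_iff.1 (tendsto_gridNode_floor ht.1.le hlt)).2] with n hn
      exact ⟨hn, (gridNode_mem hT _ _).2⟩

/-- An expected integral may be computed as an integral over the product space. -/
lemma hasFiniteExpectedIntegral_of_integrable [SFinite P] (hT : 0 ≤ T) {f g : ℝ → Ω → ℝ}
    (hg : Integrable (fun q : Ω × ℝ => g q.2 q.1) (spaceTime P T))
    (hfg : ∀ᵐ ω ∂P, ∀ᵐ t ∂volume.restrict (Ioc 0 T), f t ω = g t ω) :
    HasFiniteExpectedIntegral P T f ∧
      expectedIntegral P T f = ∫ q, g q.2 q.1 ∂spaceTime P T := by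
  have hint : (fun ω => ∫ t in (0 : ℝ)..T, f t ω) =ᵐ[P]
      fun ω => ∫ t in Ioc 0 T, g t ω := by
    filter_upwards [hfg] with ω hω
    rw [intervalIntegral.integral_of_le hT]
    exact integral_congr_ae hω
  refine ⟨⟨?_, ?_⟩, ?_⟩
  · filter_upwards [hfg, hg.prod_right_ae] with ω hω h
    rw [intervalIntegrable_iff_integrableOn_Ioc_of_le hT]
    exact Integrable.congr h (hω.mono fun t ht => ht.symm)
  · exact hg.integral_prod_left.congr hint.symm
  · rw [expectedIntegral, integral_congr_ae hint, integral_prod _ hg]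

lemma HasFiniteExpectedIntegral.const_mul {f : ℝ → Ω → ℝ} (h : HasFiniteExpectedIntegral P T f)
    (c : ℝ) : HasFiniteExpectedIntegral P T (fun t ω => c * f t ω) := by
  refine ⟨h.1.mono fun ω hω => hω.const_mul c, ?_⟩
  simp_rw [intervalIntegral.integral_const_mul]
  exact h.2.const_mul c

lemma expectedIntegral_const_mul (c : ℝ) (f : ℝ → Ω → ℝ) :
    expectedIntegral P T (fun t ω => c * f t ω) = c * expectedIntegral P T f := by
  simp_rw [expectedIntegral, intervalIntegral.integral_const_mul, integral_const_mul]

end Joint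

/-! ### Null sets under the usual conditions -/

section Completeness

variable {Ω : Type*} {m : MeasurableSpace Ω} {P : Measure Ω} {𝓕 : Filtration ℝ≥0 m}

lemma UsualConditions.ae_trim (h : UsualConditions 𝓕 P) (t : ℝ≥0) {p : Ω → Prop}
    (hp : ∀ᵐ ω ∂P, p ω) : ∀ᵐ ω ∂P.trim (𝓕.le t), p ω := by
  have h0 : P {ω | ¬ p ω} = 0 := hp
  have hm : MeasurableSet[𝓕 t] {ω | ¬ p ω} := 𝓕.mono (zero_le (a := t)) _ (h.complete _ h0)
  rw [ae_iff, trim_measurableSet_eq _ hm, h0]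

/-- Every subset of the null set where `f` and its version `g` differ lies in `𝓕 0`, so the
preimages under `f` and `g` differ by measurable pieces only. -/
lemma UsualConditions.stronglyMeasurable_of_ae (h : UsualConditions 𝓕 P) {t : ℝ≥0} {f : Ω → ℝ}
    (hf : AEStronglyMeasurable[𝓕 t] f P) : StronglyMeasurable[𝓕 t] f := by
  obtain ⟨g, hg, hfg⟩ := hf
  have hN : ∀ A : Set Ω, A ⊆ {ω | f ω ≠ g ω} → MeasurableSet[𝓕 t] A := fun A hA =>
    𝓕.mono (zero_le (a := t)) _ (h.complete _ (measure_mono_null hA hfg))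
  suffices Measurable[𝓕 t] f from this.stronglyMeasurable
  intro B hB
  have : f ⁻¹' B = (g ⁻¹' B \ {ω | f ω ≠ g ω}) ∪ (f ⁻¹' B ∩ {ω | f ω ≠ g ω}) := by
    ext ω
    by_cases hω : f ω = g ω <;> simp [hω]
  rw [this]
  exact ((hg.measurable hB).diff (hN _ subset_rfl)).union (hN _ inter_subset_right)

end Completeness

end

noncomputable section

/-! ### The price process: domination, adapted integrals, martingale identity -/

section Driver

variable {Ω : Type*} {m : MeasurableSpace Ω} {P : Measure Ω} {T : ℝ} {𝓕 : Filtration ℝ≥0 m}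
  {S : ℝ≥0 → Ω → ℝ}

lemma RightContinuousPaths.tendsto (h : RightContinuousPaths P S) :
    ∀ᵐ ω ∂P, ∀ t, 0 ≤ t →
      Tendsto (fun s : ℝ => S s.toNNReal ω) (𝓝[>] t) (𝓝 (S t.toNNReal ω)) := by
  filter_upwards [h] with ω hω t ht
  refine (hω t.toNNReal).tendsto.comp (tendsto_nhdsWithin_iff.2 ⟨?_, ?_⟩)
  · exact (continuous_real_toNNReal.tendsto t).mono_left nhdsWithin_le_nhds
  · filter_upwards [self_mem_nhdsWithin] with s hs
    exact (Real.toNNReal_lt_toNNReal_iff (ht.trans_lt hs)).2 hs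

/-- A right-continuous process with square-integrable supremum is dominated by a
square-integrable random variable. -/
lemma exists_memLp_bound (hT : 0 ≤ T) (hS : ∀ t, StronglyMeasurable (S t))
    (hrc : RightContinuousPaths P S) (hsq : SquareIntegrableSup P T S) :
    ∃ M : Ω → ℝ, MemLp M 2 P ∧ ∀ᵐ ω ∂P, ∀ t ∈ Icc 0 T, |S t.toNNReal ω| ≤ M ω := by
  -- A countable supremum is measurable, whereas the one over all times need not be.
  -- Right-continuity recovers every `t < T`, and clamping makes `T` itself a node.
  set N : Ω → ℝ≥0∞ := fun ω => ⨆ n : ℕ, ⨆ k : ℤ, ‖S (gridNode T n k).toNNReal ω‖ₑ with hN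
  have hNm : Measurable N :=
    .iSup fun n => .iSup fun k => (hS _).measurable.enorm
  have hN2 : ∫⁻ ω, N ω ^ 2 ∂P < ∞ := by
    refine lt_of_le_of_lt (lintegral_mono fun ω => ?_) hsq
    refine pow_le_pow_left' (iSup_le fun n => iSup_le fun k => ?_) 2
    refine le_iSup₂ (f := fun (t : ℝ≥0) (_ : (t : ℝ) ≤ T) => ‖S t ω‖ₑ)
      (gridNode T n k).toNNReal ?_
    rw [Real.coe_toNNReal _ (gridNode_mem hT n k).1]
    exact (gridNode_mem hT n k).2
  have hfin : ∀ᵐ ω ∂P, N ω < ∞ := by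
    filter_upwards [ae_lt_top (hNm.pow_const 2) hN2.ne] with ω hω
    by_contra hc
    simp [top_unique (not_lt.1 hc)] at hω
  refine ⟨fun ω => (N ω).toReal, ⟨hNm.ennreal_toReal.aestronglyMeasurable, ?_⟩, ?_⟩
  · rw [eLpNorm_lt_top_iff_lintegral_rpow_enorm_lt_top (by simp) (by simp)]
    refine lt_of_le_of_lt (lintegral_mono_ae ?_) hN2
    filter_upwards [hfin] with ω hω
    simp only [ENNReal.toReal_ofNat, ENNReal.rpow_ofNat]
    rw [Real.enorm_of_nonneg ENNReal.toReal_nonneg, ENNReal.ofReal_toReal hω.ne]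
  · filter_upwards [hfin, hrc.tendsto] with ω hω hlim t ht
    have hb : ∀ n : ℕ, |S (gridNode T n ⌊((n : ℝ) + 1) * t⌋).toNNReal ω| ≤ (N ω).toReal := by
      intro n
      have : ‖S (gridNode T n ⌊((n : ℝ) + 1) * t⌋).toNNReal ω‖ₑ ≤ N ω :=
        le_iSup₂ (f := fun (n : ℕ) (k : ℤ) => ‖S (gridNode T n k).toNNReal ω‖ₑ) n _
      simpa using ENNReal.toReal_mono hω.ne this
    rcases ht.2.eq_or_lt with rfl | hlt
    · have h0 := hb 0
      rwa [gridNode_floor_right hT] at h0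
    · exact le_of_tendsto ((hlim t ht.1).comp (tendsto_gridNode_floor ht.1 hlt)).abs
        (Eventually.of_forall hb)

lemma aestronglyMeasurable_driver [SFinite P] (hT : 0 ≤ T)
    (hS : ∀ t ∈ Icc 0 T, Measurable (S t.toNNReal)) (hrc : RightContinuousPaths P S) :
    AEStronglyMeasurable (fun q : Ω × ℝ => S q.2.toNNReal q.1) (spaceTime P T) := by
  refine aestronglyMeasurable_uncurry_of_rightContinuous
    (Y := fun t ω => S t.toNNReal ω) hT hS ?_
  filter_upwards [hrc.tendsto] with ω hω t ht
  exact (hω t ht.1).mono_left (nhdsWithin_mono _ fun s hs => hs.1)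

lemma MeasureTheory.MemLp.of_sq_le_fst [IsFiniteMeasure P] {f : Ω × ℝ → ℝ} {g : Ω → ℝ}
    (hf : AEStronglyMeasurable f (spaceTime P T)) (hg : Integrable g P)
    (h : ∀ᵐ q ∂spaceTime P T, f q ^ 2 ≤ g q.1) : MemLp f 2 (spaceTime P T) := by
  rw [memLp_two_iff_integrable_sq hf]
  refine (hg.comp_fst (volume.restrict (Ioc 0 T))).mono' (hf.pow 2) ?_
  filter_upwards [h] with q hq
  simpa using hq

lemma memLp_driver [IsFiniteMeasure P] (hT : 0 ≤ T) (hS : ∀ t, StronglyMeasurable (S t))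
    (hrc : RightContinuousPaths P S) (hsq : SquareIntegrableSup P T S) :
    MemLp (fun q : Ω × ℝ => S q.2.toNNReal q.1) 2 (spaceTime P T) := by
  obtain ⟨M, hM, hb⟩ := exists_memLp_bound hT hS hrc hsq
  refine MemLp.of_sq_le_fst (aestronglyMeasurable_driver hT (fun t _ => (hS _).measurable) hrc)
    hM.integrable_sq (ae_spaceTime_of_ae_forall
      (p := fun ω t => S t.toNNReal ω ^ 2 ≤ M ω ^ 2) ?_)
  filter_upwards [hb] with ω hω t ht
  exact sq_le_sq' (abs_le.1 (hω t (Ioc_subset_Icc_self ht))).1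
    (abs_le.1 (hω t (Ioc_subset_Icc_self ht))).2

lemma aestronglyMeasurable_integral_driver [IsFiniteMeasure P] (hT : 0 ≤ T)
    (hS : ∀ t ∈ Icc 0 T, Measurable (S t.toNNReal)) (hrc : RightContinuousPaths P S) {g : ℝ → ℝ}
    (hg : Measurable g) :
    AEStronglyMeasurable (fun ω => ∫ s in (0 : ℝ)..T, S s.toNNReal ω * g s) P := by
  simp_rw [intervalIntegral.integral_of_le hT]
  exact ((aestronglyMeasurable_driver hT hS hrc).mul
    (hg.comp measurable_snd).aestronglyMeasurable).integral_prod_right'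

/-- The integral of a right-continuous adapted process is adapted. -/
lemma stronglyMeasurable_integral_driver [IsFiniteMeasure P] (h𝓕 : UsualConditions 𝓕 P)
    (hS : StronglyAdapted 𝓕 S) (hrc : RightContinuousPaths P S) {g : ℝ → ℝ} (hg : Measurable g)
    (t : ℝ≥0) :
    StronglyMeasurable[𝓕 t] (fun ω => ∫ s in (0 : ℝ)..t, S s.toNNReal ω * g s) := by
  -- Fubini is applied with `𝓕 t` as the ambient σ-algebra, the trimmed measure and horizon `t`, so
  -- that the version obtained is `𝓕 t`-measurable.
  obtain ⟨f, hf, hfe⟩ := @aestronglyMeasurable_integral_driver Ω (𝓕 t) (P.trim (𝓕.le t)) t S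
    inferInstance t.2 (fun s hs => ((hS s.toNNReal).mono
      (𝓕.mono (Real.toNNReal_le_iff_le_coe.2 hs.2))).measurable) (h𝓕.ae_trim t hrc) g hg
  exact h𝓕.stronglyMeasurable_of_ae ⟨f, hf, ae_eq_of_ae_eq_trim hfe⟩

/-- Against adapted square-integrable integrands, a martingale may be replaced by its terminal
value. -/
lemma MeasureTheory.Martingale.integral_spaceTime_mul [IsFiniteMeasure P] (hS : Martingale S 𝓕 P)
    (hS2 : MemLp (fun q : Ω × ℝ => S q.2.toNNReal q.1) 2 (spaceTime P T))
    (hST : MemLp (S T.toNNReal) 2 P) {y : ℝ → Ω → ℝ}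
    (hy : MemLp (fun q : Ω × ℝ => y q.2 q.1) 2 (spaceTime P T))
    (hya : ∀ t ∈ Ioc 0 T, StronglyMeasurable[𝓕 t.toNNReal] (y t)) :
    ∫ q, S q.2.toNNReal q.1 * y q.2 q.1 ∂spaceTime P T =
      ∫ ω, S T.toNNReal ω * (∫ t in Ioc 0 T, y t ω) ∂P := by
  have hST' : MemLp (fun q : Ω × ℝ => S T.toNNReal q.1) 2 (spaceTime P T) :=
    hST.comp_fst (volume.restrict (Ioc 0 T))
  have h1 : Integrable (fun q : Ω × ℝ => S q.2.toNNReal q.1 * y q.2 q.1) (spaceTime P T) :=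
    hS2.integrable_mul hy
  have h2 : Integrable (fun q : Ω × ℝ => S T.toNNReal q.1 * y q.2 q.1) (spaceTime P T) :=
    hST'.integrable_mul hy
  have h3 : ∫ ω, S T.toNNReal ω * (∫ t in Ioc 0 T, y t ω) ∂P =
      ∫ q, S T.toNNReal q.1 * y q.2 q.1 ∂spaceTime P T := by
    rw [integral_prod _ h2]
    simp_rw [integral_const_mul]
  -- With time as the outer variable it remains to see `E[S_t y_t] = E[S_T y_t]` for almost every
  -- fixed `t`, by conditioning on `𝓕 t`.
  rw [h3, integral_prod_symm _ h1, integral_prod_symm _ h2]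
  refine integral_congr_ae ?_
  filter_upwards [h1.prod_left_ae, h2.prod_left_ae, ae_restrict_mem measurableSet_Ioc]
    with t ht1 ht2 ht
  have hc := condExp_mul_of_stronglyMeasurable_right (μ := P) (f := S T.toNNReal)
    (hya t ht) ht2 (hS.integrable _)
  have hc' := hS.condExp_ae_eq (Real.toNNReal_le_toNNReal ht.2)
  rw [← integral_condExp (𝓕.le t.toNNReal) (f := fun ω => S T.toNNReal ω * y t ω)]
  refine integral_congr_ae ?_
  filter_upwards [hc, hc'] with ω h1 h2
  have : (P[fun ω => S T.toNNReal ω * y t ω | 𝓕 t.toNNReal]) ω = S t.toNNReal ω * y t ω := by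
    rw [← h2]; exact h1
  exact this.symm

/-- A random variable measurable with respect to the trivial `𝓕 0` is almost surely constant. -/
lemma TrivialAtZero.ae_eq_integral [IsProbabilityMeasure P] (h0 : TrivialAtZero 𝓕 P) {f : Ω → ℝ}
    (hf : StronglyMeasurable[𝓕 0] f) (hfi : Integrable f P) : ∀ᵐ ω ∂P, f ω = ∫ ω', f ω' ∂P := by
  have key : ∀ g : Ω → ℝ, StronglyMeasurable[𝓕 0] g → Integrable g P →
      ∀ᵐ ω ∂P, g ω ≤ ∫ ω', g ω' ∂P := by
    intro g hg hgi
    have hm : MeasurableSet[𝓕 0] {ω | ∫ ω', g ω' ∂P < g ω} := hg.measurable measurableSet_Ioi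
    rcases h0 _ hm with h | h
    · rw [ae_iff]; simpa using h
    · exfalso
      -- A variable almost surely above its mean would have a positive deviation with zero integral.
      have hae : ∀ᵐ ω ∂P, ∫ ω', g ω' ∂P < g ω := (mem_ae_iff_prob_eq_one (𝓕.le 0 _ hm)).2 h
      have hz : ∫ ω, (g ω - ∫ ω', g ω' ∂P) ∂P = 0 := by
        rw [integral_sub hgi (integrable_const _)]; simp
      rw [integral_eq_zero_iff_of_nonneg_ae (hae.mono fun ω h => (sub_pos.2 h).le)
        (hgi.sub (integrable_const _))] at hz
      obtain ⟨ω, h1, h2⟩ := (hae.and hz).exists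
      exact absurd h2 (sub_pos.2 h1).ne'
  filter_upwards [key f hf hfi, key (-f) hf.neg hfi.neg] with ω h1 h2
  simp only [Pi.neg_apply, integral_neg] at h2
  linarith

end Driver

end

/-! ### Calculus of absolutely continuous functions -/

noncomputable section

/-- `f` is absolutely continuous on `[0, T]`, with derivative `f'` at almost every time. -/
structure HasACDeriv (T : ℝ) (f f' : ℝ → ℝ) : Prop where
  absCont : AbsolutelyContinuousOnInterval f 0 T
  hasDerivAt : ∀ᵐ t ∂volume.restrict (Ioc 0 T), HasDerivAt f (f' t) t

namespace HasACDeriv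

variable {T : ℝ} {f f' g g' : ℝ → ℝ}

lemma _root_.AbsolutelyContinuousOnInterval.hasACDeriv (hT : 0 ≤ T)
    (h : AbsolutelyContinuousOnInterval f 0 T) : HasACDeriv T f (deriv f) := by
  refine ⟨h, ?_⟩
  rw [ae_restrict_iff' measurableSet_Ioc]
  filter_upwards [h.ae_differentiableAt] with t ht hmem
  exact (ht (by rw [uIcc_of_le hT]; exact Ioc_subset_Icc_self hmem)).hasDerivAt

lemma deriv_ae_eq (h : HasACDeriv T f f') :
    ∀ᵐ t ∂volume.restrict (Ioc 0 T), deriv f t = f' t := by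
  filter_upwards [h.hasDerivAt] with t ht using ht.deriv

lemma congr_deriv (h : HasACDeriv T f f')
    (hfg : ∀ᵐ t ∂volume.restrict (Ioc 0 T), f' t = g' t) : HasACDeriv T f g' := by
  refine ⟨h.absCont, ?_⟩
  filter_upwards [h.hasDerivAt, hfg] with t ht h2
  rwa [← h2]

lemma integrableOn (hT : 0 ≤ T) (h : HasACDeriv T f f') : IntegrableOn f' (Ioc 0 T) := by
  have := h.absCont.intervalIntegrable_deriv
  rw [intervalIntegrable_iff_integrableOn_Ioc_of_le hT] at this
  exact Integrable.congr this h.deriv_ae_eq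

lemma integral_eq_sub (h : HasACDeriv T f f') {t : ℝ} (ht : t ∈ Icc 0 T) :
    ∫ s in Ioc 0 t, f' s = f t - f 0 := by
  have h1 : AbsolutelyContinuousOnInterval f 0 t :=
    h.absCont.mono (by
      rw [uIcc_of_le ht.1, uIcc_of_le (ht.1.trans ht.2)]; exact Icc_subset_Icc_right ht.2)
  rw [← h1.integral_deriv_eq_sub, intervalIntegral.integral_of_le ht.1]
  refine integral_congr_ae ?_
  filter_upwards [ae_restrict_of_ae_restrict_of_subset (Ioc_subset_Ioc_right ht.2)
    h.deriv_ae_eq] with s hs using hs.symm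

lemma mul (hf : HasACDeriv T f f') (hg : HasACDeriv T g g') :
    HasACDeriv T (fun t => f t * g t) (fun t => f' t * g t + f t * g' t) := by
  refine ⟨hf.absCont.fun_mul hg.absCont, ?_⟩
  filter_upwards [hf.hasDerivAt, hg.hasDerivAt] with t h1 h2 using h1.mul h2

lemma sub (hf : HasACDeriv T f f') (hg : HasACDeriv T g g') :
    HasACDeriv T (fun t => f t - g t) (fun t => f' t - g' t) := by
  refine ⟨hf.absCont.fun_sub hg.absCont, ?_⟩
  filter_upwards [hf.hasDerivAt, hg.hasDerivAt] with t h1 h2 using h1.sub h2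

lemma of_hasDerivAt (h : ∀ t, HasDerivAt f (f' t) t) (hc : Continuous f') : HasACDeriv T f f' := by
  refine ⟨ContDiffOn.absolutelyContinuousOnInterval ?_, Eventually.of_forall h⟩
  have hd : deriv f = f' := funext fun t => (h t).deriv
  exact (contDiff_one_iff_deriv.2 ⟨fun t => (h t).differentiableAt, hd ▸ hc⟩).contDiffOn

lemma of_integral (hT : 0 ≤ T) (h : IntegrableOn f' (Ioc 0 T)) :
    HasACDeriv T (fun t => ∫ s in (0 : ℝ)..t, f' s) f' := by
  have h1 : IntervalIntegrable f' volume 0 T :=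
    (intervalIntegrable_iff_integrableOn_Ioc_of_le hT).2 h
  refine ⟨h1.absolutelyContinuousOnInterval_intervalIntegral left_mem_uIcc, ?_⟩
  rw [ae_restrict_iff' measurableSet_Ioc]
  filter_upwards [h1.ae_hasDerivAt_integral] with t ht hmem
  exact ht (by rw [uIcc_of_le hT]; exact Ioc_subset_Icc_self hmem) 0 left_mem_uIcc

lemma sq_sub_le (hT : 0 < T) (h : HasACDeriv T f f')
    (h2 : IntegrableOn (fun s => f' s ^ 2) (Ioc 0 T)) {t : ℝ} (ht : t ∈ Icc 0 T) :
    (f t - f 0) ^ 2 ≤ T * ∫ s in Ioc 0 T, f' s ^ 2 := by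
  have hi := (h.integrableOn hT.le).abs
  set b := ∫ s in Ioc 0 T, |f' s| with hb
  have h1 : |f t - f 0| ≤ b := by
    rw [← h.integral_eq_sub ht]
    exact (abs_integral_le_integral_abs).trans (setIntegral_mono_set hi
      (Eventually.of_forall fun s => abs_nonneg _)
      (Ioc_subset_Ioc_right ht.2).eventuallyLE)
  -- Cauchy–Schwarz, obtained as nonnegativity of the variance of `|f'|` about its mean `b / T`.
  have h3 : 0 ≤ ∫ s in Ioc 0 T, (|f' s| - b / T) ^ 2 := integral_nonneg fun s => sq_nonneg _
  have h4 : ∫ s in Ioc 0 T, (|f' s| - b / T) ^ 2 =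
      (∫ s in Ioc 0 T, f' s ^ 2) - 2 * (b / T) * b + T * (b / T) ^ 2 := by
    have : ∀ s, (|f' s| - b / T) ^ 2 = f' s ^ 2 - 2 * (b / T) * |f' s| + (b / T) ^ 2 := by
      intro s; rw [sub_sq, sq_abs]; ring
    simp_rw [this]
    have hs : Integrable (fun s => f' s ^ 2 - 2 * (b / T) * |f' s|) (volume.restrict (Ioc 0 T)) :=
      h2.sub (hi.const_mul _)
    rw [integral_add hs (integrable_const _),
      integral_sub h2 (hi.const_mul _), integral_const_mul, ← hb]
    simp [hT.le]
  rw [h4] at h3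
  have h5 : b ^ 2 ≤ T * ∫ s in Ioc 0 T, f' s ^ 2 := by
    have : T * (-(2 * (b / T) * b) + T * (b / T) ^ 2) = - b ^ 2 := by field_simp; ring
    nlinarith [mul_nonneg hT.le h3]
  exact (sq_le_sq' (abs_le.1 h1).1 (abs_le.1 h1).2).trans h5

/-- Left quotients use only past values, so they preserve adaptedness. The clamp at `0` is inactive
for large `n` because `t > 0`. -/
lemma tendsto_left_quotient {t d : ℝ} (ht : 0 < t) (h : HasDerivAt f d t) :
    Tendsto (fun n : ℕ => ((n : ℝ) + 1) * (f t - f (max 0 (t - 1 / ((n : ℝ) + 1))))) atTop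
      (𝓝 d) := by
  have h0 := tendsto_one_div_add_atTop_nhds_zero_nat (𝕜 := ℝ)
  have h1 : Tendsto (fun n : ℕ => t - 1 / ((n : ℝ) + 1)) atTop (𝓝[≠] t) := by
    refine tendsto_nhdsWithin_iff.2 ⟨by simpa using tendsto_const_nhds.sub h0, ?_⟩
    refine Eventually.of_forall fun n => ?_
    have : (0 : ℝ) < 1 / ((n : ℝ) + 1) := by positivity
    exact (sub_lt_self t this).ne
  refine ((hasDerivAt_iff_tendsto_slope.1 h).comp h1).congr' ?_
  filter_upwards [h0.eventually (gt_mem_nhds ht)] with n hn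
  have hp : (0 : ℝ) < (n : ℝ) + 1 := by positivity
  rw [max_eq_right (sub_nonneg.2 hn.le), Function.comp_apply, slope_def_field]
  field_simp
  ring

end HasACDeriv

/-! ### Adapted velocities and square-integrability of strategies -/

section Velocity

variable {Ω : Type*} {m : MeasurableSpace Ω} {P : Measure Ω} {T X : ℝ} {𝓕 : Filtration ℝ≥0 m}
  {x v : ℝ → Ω → ℝ}

/-- `v` is an adapted square-integrable version of the time derivative of `x`. -/
structure IsVelocity (𝓕 : Filtration ℝ≥0 m) (P : Measure Ω) (T : ℝ) (x v : ℝ → Ω → ℝ) :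
    Prop where
  adapted : ∀ t ∈ Ioc 0 T, StronglyMeasurable[𝓕 t.toNNReal] (v t)
  memLp : MemLp (fun q : Ω × ℝ => v q.2 q.1) 2 (spaceTime P T)
  path : ∀ᵐ ω ∂P, HasACDeriv T (fun t => x t ω) (fun t => v t ω)

lemma lintegral_spaceTime_lt_top_iff [SFinite P]
    (hv : AEStronglyMeasurable (fun q : Ω × ℝ => v q.2 q.1) (spaceTime P T))
    (hp : ∀ᵐ ω ∂P, HasACDeriv T (fun t => x t ω) (fun t => v t ω)) :
    (∫⁻ ω, (∫⁻ t in Ioc 0 T, ‖deriv (fun s => x s ω) t‖ₑ ^ 2) ∂P < ∞) ↔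
      MemLp (fun q : Ω × ℝ => v q.2 q.1) 2 (spaceTime P T) := by
  have h1 : ∫⁻ ω, (∫⁻ t in Ioc 0 T, ‖deriv (fun s => x s ω) t‖ₑ ^ 2) ∂P =
      ∫⁻ q, ‖v q.2 q.1‖ₑ ^ 2 ∂spaceTime P T := by
    rw [lintegral_prod _ (hv.enorm.pow_const 2)]
    refine lintegral_congr_ae ?_
    filter_upwards [hp] with ω hω
    refine lintegral_congr_ae ?_
    filter_upwards [hω.deriv_ae_eq] with t ht
    rw [ht]
  rw [h1, MemLp, eLpNorm_lt_top_iff_lintegral_rpow_enorm_lt_top (by simp) (by simp)]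
  simp [hv]

lemma IsAdmissible.measurable_of_mem (hx : IsAdmissible 𝓕 P T X x) {t : ℝ} (ht : t ∈ Icc 0 T) :
    StronglyMeasurable[𝓕 t.toNNReal] (x t) := by
  have := hx.adapted t.toNNReal (by rw [Real.coe_toNNReal _ ht.1]; exact ht.2)
  rwa [Real.coe_toNNReal _ ht.1] at this

lemma IsAdmissible.continuousOn (hT : 0 ≤ T) (hx : IsAdmissible 𝓕 P T X x) :
    ∀ᵐ ω ∂P, ContinuousOn (fun t => x t ω) (Icc 0 T) := by
  filter_upwards [hx.absCont] with ω hω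
  simpa [uIcc_of_le hT] using hω.continuousOn

lemma IsAdmissible.aestronglyMeasurable [SFinite P] (hT : 0 ≤ T) (hx : IsAdmissible 𝓕 P T X x) :
    AEStronglyMeasurable (fun q : Ω × ℝ => x q.2 q.1) (spaceTime P T) := by
  refine aestronglyMeasurable_uncurry_of_rightContinuous hT
    (fun t ht => ((hx.measurable_of_mem ht).mono (𝓕.le _)).measurable) ?_
  filter_upwards [hx.continuousOn hT] with ω hω t ht
  exact (hω t (Ico_subset_Icc_self ht)).mono_left
    (nhdsWithin_mono _ fun s hs => ⟨ht.1.trans hs.1.le, hs.2⟩)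

lemma IsAdmissible.exists_isVelocity [SFinite P] (hT : 0 ≤ T) (hx : IsAdmissible 𝓕 P T X x) :
    ∃ v, IsVelocity 𝓕 P T x v := by
  set y : ℕ → ℝ → Ω → ℝ := fun n t ω =>
    ((n : ℝ) + 1) * (x t ω - x (max 0 (t - 1 / ((n : ℝ) + 1))) ω) with hy
  have hmem : ∀ (n : ℕ) {t : ℝ}, t ∈ Icc 0 T → max 0 (t - 1 / ((n : ℝ) + 1)) ∈ Icc 0 t := by
    intro n t ht
    have : (0 : ℝ) < 1 / ((n : ℝ) + 1) := by positivity
    exact ⟨le_max_left _ _, max_le ht.1 (by linarith)⟩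
  have hya : ∀ n, ∀ t ∈ Icc 0 T, StronglyMeasurable[𝓕 t.toNNReal] (y n t) := by
    intro n t ht
    have h1 := (hx.measurable_of_mem (Icc_subset_Icc_right ht.2 (hmem n ht))).mono
      (𝓕.mono (Real.toNNReal_le_toNNReal (hmem n ht).2))
    exact ((hx.measurable_of_mem ht).sub h1).const_mul _
  have hyj : ∀ n, AEStronglyMeasurable (fun q : Ω × ℝ => y n q.2 q.1) (spaceTime P T) := by
    intro n
    refine aestronglyMeasurable_uncurry_of_rightContinuous hT
      (fun t ht => ((hya n t ht).mono (𝓕.le _)).measurable) ?_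
    filter_upwards [hx.continuousOn hT] with ω hω t ht
    have h1 : ContinuousOn (fun t => y n t ω) (Icc 0 T) := by
      refine continuousOn_const.mul (hω.sub (hω.comp (by fun_prop) fun s hs => ?_))
      exact Icc_subset_Icc_right hs.2 (hmem n hs)
    exact (h1 t (Ico_subset_Icc_self ht)).mono_left
      (nhdsWithin_mono _ fun s hs => ⟨ht.1.trans hs.1.le, hs.2⟩)
  -- `limUnder` is total and measurable even where the quotients diverge, so `v t` is adapted for
  -- every `t`; it equals the derivative wherever the latter exists.
  set v : ℝ → Ω → ℝ := fun t ω => limUnder atTop fun n => y n t ω with hv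
  have hvj : AEStronglyMeasurable (fun q : Ω × ℝ => v q.2 q.1) (spaceTime P T) := by
    refine ⟨fun q => limUnder atTop fun n => (hyj n).mk _ q,
      StronglyMeasurable.limUnder fun n => (hyj n).stronglyMeasurable_mk, ?_⟩
    filter_upwards [ae_all_iff.2 fun n => (hyj n).ae_eq_mk] with q hq
    simp only [hv, hq]
  have hp : ∀ᵐ ω ∂P, HasACDeriv T (fun t => x t ω) (fun t => v t ω) := by
    filter_upwards [hx.absCont] with ω hω
    refine (hω.hasACDeriv hT).congr_deriv ?_
    filter_upwards [(hω.hasACDeriv hT).hasDerivAt, ae_restrict_mem measurableSet_Ioc] with t h ht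
    exact (HasACDeriv.tendsto_left_quotient ht.1 h).limUnder_eq.symm
  exact ⟨v, fun t ht => 
      @StronglyMeasurable.limUnder _ _ _ (𝓕 t.toNNReal) _ _ _ _ _ _ _
        fun n => hya n t (Ioc_subset_Icc_self ht),
    (lintegral_spaceTime_lt_top_iff hvj hp).1 hx.energy, hp⟩

lemma memLp_of_hasACDeriv [IsFiniteMeasure P] (hT : 0 < T)
    (hx : AEStronglyMeasurable (fun q : Ω × ℝ => x q.2 q.1) (spaceTime P T))
    (hv : MemLp (fun q : Ω × ℝ => v q.2 q.1) 2 (spaceTime P T))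
    (hp : ∀ᵐ ω ∂P, HasACDeriv T (fun t => x t ω) (fun t => v t ω)) (h0 : ∀ᵐ ω ∂P, x 0 ω = X) :
    MemLp (fun q : Ω × ℝ => x q.2 q.1) 2 (spaceTime P T) := by
  have hi : Integrable (fun q : Ω × ℝ => v q.2 q.1 ^ 2) (spaceTime P T) := hv.integrable_sq
  refine MemLp.of_sq_le_fst (g := fun ω => 2 * X ^ 2 + 2 * (T * ∫ t in Ioc 0 T, v t ω ^ 2)) hx
    ((integrable_const _).add ((hi.integral_prod_left.const_mul _).const_mul _))
    (ae_spaceTime_of_ae_forall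
      (p := fun ω t => x t ω ^ 2 ≤ 2 * X ^ 2 + 2 * (T * ∫ t in Ioc 0 T, v t ω ^ 2)) ?_)
  filter_upwards [hp, hi.prod_right_ae, h0] with ω h1 h2 h3 t ht
  have := h1.sq_sub_le hT h2 (Ioc_subset_Icc_self ht)
  simp only [h3] at this
  -- `2X² + 2(x - X)² - x² = (x - 2X)²`.
  nlinarith [sq_nonneg (x t ω - X - X)]

lemma IsAdmissible.memLp [IsFiniteMeasure P] (hT : 0 < T) (hx : IsAdmissible 𝓕 P T X x)
    (hv : IsVelocity 𝓕 P T x v) :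
    MemLp (fun q : Ω × ℝ => x q.2 q.1) 2 (spaceTime P T) :=
  memLp_of_hasACDeriv hT (hx.aestronglyMeasurable hT.le) hv.memLp hv.path hx.initial

lemma MeasureTheory.MemLp.continuous_mul_snd [IsFiniteMeasure P] {f : Ω × ℝ → ℝ}
    (hf : MemLp f 2 (spaceTime P T)) {g : ℝ → ℝ} (hg : Continuous g) :
    MemLp (fun q : Ω × ℝ => g q.2 * f q) 2 (spaceTime P T) := by
  obtain ⟨K, hK⟩ := isCompact_Icc.exists_bound_of_continuousOn (hg.continuousOn (s := Icc 0 T))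
  refine hf.of_le_mul (c := K)
    ((hg.measurable.comp measurable_snd).aestronglyMeasurable.mul hf.1) ?_
  filter_upwards [ae_spaceTime_of_ae_forall (P := P) (T := T) (p := fun _ t => ‖g t‖ ≤ K)
    (Eventually.of_forall fun _ t ht => hK t (Ioc_subset_Icc_self ht))] with q hq
  rw [norm_mul]
  gcongr

end Velocity

end

/-! ### Hyperbolic functions, uniformly in `ν` -/

noncomputable section

/-- A solution `(σ, C)` of `σ' = -C`, `C' = -ν² σ` with terminal values `0` and `1`: the functions
`sinh (ν (T - t)) / ν` and `cosh (ν (T - t))`, or `T - t` and `1` when `ν = 0`. -/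
structure IsHyperbolicPair (T ν : ℝ) (σ C : ℝ → ℝ) : Prop where
  hasDerivAt_sinh : ∀ t, HasDerivAt σ (-C t) t
  hasDerivAt_cosh : ∀ t, HasDerivAt C (-(ν ^ 2 * σ t)) t
  sq_sub_sq : ∀ t, C t ^ 2 - ν ^ 2 * σ t ^ 2 = 1
  one_add_pos : ∀ t, 0 < 1 + C t
  sinh_terminal : σ T = 0
  sinh_initial : σ 0 ≠ 0

/-- The half-argument tangent `σ / (1 + C)`. -/
def halfTanh (σ C : ℝ → ℝ) (t : ℝ) : ℝ := σ t * (1 + C t)⁻¹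

namespace IsHyperbolicPair

variable {T ν : ℝ} {σ C : ℝ → ℝ}

lemma continuous_sinh (h : IsHyperbolicPair T ν σ C) : Continuous σ :=
  continuous_iff_continuousAt.2 fun t => (h.hasDerivAt_sinh t).continuousAt

lemma continuous_cosh (h : IsHyperbolicPair T ν σ C) : Continuous C :=
  continuous_iff_continuousAt.2 fun t => (h.hasDerivAt_cosh t).continuousAt

lemma continuous_inv (h : IsHyperbolicPair T ν σ C) : Continuous fun t => (1 + C t)⁻¹ :=
  (continuous_const.add h.continuous_cosh).inv₀ fun t => (h.one_add_pos t).ne'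

lemma continuous_halfTanh (h : IsHyperbolicPair T ν σ C) : Continuous (halfTanh σ C) :=
  h.continuous_sinh.mul h.continuous_inv

lemma hasDerivAt_halfTanh (h : IsHyperbolicPair T ν σ C) (t : ℝ) :
    HasDerivAt (halfTanh σ C) (-(1 + C t)⁻¹) t := by
  have hne := (h.one_add_pos t).ne'
  refine ((h.hasDerivAt_sinh t).mul
    (((h.hasDerivAt_cosh t).const_add 1).inv hne)).congr_deriv ?_
  simp only [Pi.inv_apply]
  field_simp
  linear_combination -(h.sq_sub_sq t)

lemma hasACDeriv_sinh (h : IsHyperbolicPair T ν σ C) : HasACDeriv T σ fun t => -C t :=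
  .of_hasDerivAt h.hasDerivAt_sinh h.continuous_cosh.neg

lemma hasACDeriv_cosh (h : IsHyperbolicPair T ν σ C) :
    HasACDeriv T C fun t => -(ν ^ 2 * σ t) :=
  .of_hasDerivAt h.hasDerivAt_cosh (continuous_const.mul h.continuous_sinh).neg

lemma hasACDeriv_halfTanh (h : IsHyperbolicPair T ν σ C) :
    HasACDeriv T (halfTanh σ C) fun t => -(1 + C t)⁻¹ :=
  .of_hasDerivAt h.hasDerivAt_halfTanh h.continuous_inv.neg

end IsHyperbolicPair

/-! ### The candidate strategy and its cost -/

section Model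

variable {Ω : Type*} {m : MeasurableSpace Ω} {P : Measure Ω}
  {T X lam ν : ℝ} {𝓕 : Filtration ℝ≥0 m} {S : ℝ≥0 → Ω → ℝ} {σ C : ℝ → ℝ} {x v : ℝ → Ω → ℝ}

/-- The standing assumptions on the unaffected price process. -/
structure IsPriceModel (𝓕 : Filtration ℝ≥0 m) (P : Measure Ω) (T : ℝ) (S : ℝ≥0 → Ω → ℝ) :
    Prop where
  usual : UsualConditions 𝓕 P
  pos : 0 < T
  martingale : Martingale S 𝓕 P
  rightCont : RightContinuousPaths P S
  sqIntegrable : SquareIntegrableSup P T S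

/-- The rescaled strategy `X / σ 0 - (lam / 2) ∫_0^t S_s / (1 + C s) ds`. -/
def reducedStrategy (X lam : ℝ) (S : ℝ≥0 → Ω → ℝ) (σ C : ℝ → ℝ) (t : ℝ) (ω : Ω) : ℝ :=
  X / σ 0 - lam / 2 * ∫ s in (0 : ℝ)..t, S s.toNNReal ω * (1 + C s)⁻¹

/-- The derivative of the rescaled strategy. -/
def reducedVelocity (lam : ℝ) (S : ℝ≥0 → Ω → ℝ) (C : ℝ → ℝ) (t : ℝ) (ω : Ω) : ℝ :=
  -(lam / 2) * ((1 + C t)⁻¹ * S t.toNNReal ω)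

/-- The candidate optimal strategy. -/
def candidate (X lam : ℝ) (S : ℝ≥0 → Ω → ℝ) (σ C : ℝ → ℝ) (t : ℝ) (ω : Ω) : ℝ :=
  σ t * reducedStrategy X lam S σ C t ω

/-- The derivative of the candidate optimal strategy. -/
def candidateVelocity (X lam : ℝ) (S : ℝ≥0 → Ω → ℝ) (σ C : ℝ → ℝ) (t : ℝ) (ω : Ω) : ℝ :=
  -C t * reducedStrategy X lam S σ C t ω + σ t * reducedVelocity lam S C t ω

namespace IsPriceModel

lemma stronglyMeasurable (hM : IsPriceModel 𝓕 P T S) (t : ℝ≥0) : StronglyMeasurable (S t) :=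
  (hM.martingale.stronglyMeasurable t).mono (𝓕.le t)

lemma memLp_terminal (hM : IsPriceModel 𝓕 P T S) : MemLp (S T.toNNReal) 2 P := by
  obtain ⟨M, hM2, hb⟩ := exists_memLp_bound hM.pos.le hM.stronglyMeasurable hM.rightCont
    hM.sqIntegrable
  refine hM2.mono (hM.stronglyMeasurable _).aestronglyMeasurable ?_
  filter_upwards [hb] with ω hω
  exact (hω T ⟨hM.pos.le, le_rfl⟩).trans (le_abs_self _)

variable [IsProbabilityMeasure P]

lemma memLp (hM : IsPriceModel 𝓕 P T S) :
    MemLp (fun q : Ω × ℝ => S q.2.toNNReal q.1) 2 (spaceTime P T) :=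
  memLp_driver hM.pos.le hM.stronglyMeasurable hM.rightCont hM.sqIntegrable

lemma memLp_reducedVelocity (hM : IsPriceModel 𝓕 P T S) (hc : IsHyperbolicPair T ν σ C) :
    MemLp (fun q : Ω × ℝ => reducedVelocity lam S C q.2 q.1) 2 (spaceTime P T) :=
  (MemLp.continuous_mul_snd hM.memLp hc.continuous_inv).const_mul _

lemma stronglyMeasurable_reducedStrategy (hM : IsPriceModel 𝓕 P T S)
    (hc : IsHyperbolicPair T ν σ C) (t : ℝ≥0) :
    StronglyMeasurable[𝓕 t] (reducedStrategy X lam S σ C t) :=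
  stronglyMeasurable_const.sub ((stronglyMeasurable_integral_driver hM.usual
    hM.martingale.stronglyAdapted hM.rightCont hc.continuous_inv.measurable t).const_mul _)

lemma hasACDeriv_reducedStrategy (hM : IsPriceModel 𝓕 P T S) (hc : IsHyperbolicPair T ν σ C) :
    ∀ᵐ ω ∂P, HasACDeriv T (fun t => reducedStrategy X lam S σ C t ω)
      (fun t => reducedVelocity lam S C t ω) := by
  have h1 : Integrable (fun q : Ω × ℝ => (1 + C q.2)⁻¹ * S q.2.toNNReal q.1) (spaceTime P T) :=
    (MemLp.continuous_mul_snd hM.memLp hc.continuous_inv).integrable one_le_two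
  filter_upwards [h1.prod_right_ae] with ω hω
  have hc1 : ∀ c : ℝ, HasACDeriv T (fun _ => c) fun _ => 0 := fun c =>
    .of_hasDerivAt (fun t => hasDerivAt_const t c) continuous_const
  have h2 := (hc1 (X / σ 0)).sub ((hc1 (lam / 2)).mul (HasACDeriv.of_integral hM.pos.le hω))
  simp only [mul_comm _ (S _ _)] at h2
  refine h2.congr_deriv (Eventually.of_forall fun t => ?_)
  simp only [reducedVelocity]
  ring

lemma reducedStrategy_zero (ω : Ω) : reducedStrategy X lam S σ C 0 ω = X / σ 0 := by
  simp [reducedStrategy]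

lemma memLp_reducedStrategy (hM : IsPriceModel 𝓕 P T S) (hc : IsHyperbolicPair T ν σ C) :
    MemLp (fun q : Ω × ℝ => reducedStrategy X lam S σ C q.2 q.1) 2 (spaceTime P T) := by
  refine memLp_of_hasACDeriv hM.pos ?_ (hM.memLp_reducedVelocity hc)
    (hM.hasACDeriv_reducedStrategy hc) (Eventually.of_forall reducedStrategy_zero)
  refine aestronglyMeasurable_uncurry_of_rightContinuous hM.pos.le (fun t ht => ?_) ?_
  · have := hM.stronglyMeasurable_reducedStrategy (X := X) (lam := lam) hc t.toNNReal
    rw [Real.coe_toNNReal _ ht.1] at this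
    exact (this.mono (𝓕.le _)).measurable
  · filter_upwards [hM.hasACDeriv_reducedStrategy (X := X) (lam := lam) hc] with ω hω t ht
    have h := hω.absCont.continuousOn
    rw [uIcc_of_le hM.pos.le] at h
    exact (h t (Ico_subset_Icc_self ht)).mono_left
      (nhdsWithin_mono _ fun s hs => ⟨ht.1.trans hs.1.le, hs.2⟩)

lemma isVelocity_candidate (hM : IsPriceModel 𝓕 P T S) (hc : IsHyperbolicPair T ν σ C) :
    IsVelocity 𝓕 P T (candidate X lam S σ C) (candidateVelocity X lam S σ C) where
  adapted t ht := by
    have := hM.stronglyMeasurable_reducedStrategy (X := X) (lam := lam) hc t.toNNReal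
    rw [Real.coe_toNNReal _ ht.1.le] at this
    exact (this.const_mul _).add (((hM.martingale.stronglyMeasurable _).const_mul _ |>.const_mul
      _).const_mul _)
  memLp := (MemLp.continuous_mul_snd (hM.memLp_reducedStrategy hc) hc.continuous_cosh.neg).add
    (MemLp.continuous_mul_snd (hM.memLp_reducedVelocity hc) hc.continuous_sinh)
  path := by
    filter_upwards [hM.hasACDeriv_reducedStrategy hc] with ω hω using hc.hasACDeriv_sinh.mul hω

lemma isAdmissible_candidate (hM : IsPriceModel 𝓕 P T S) (hc : IsHyperbolicPair T ν σ C) :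
    IsAdmissible 𝓕 P T X (candidate X lam S σ C) where
  adapted t _ := (hM.stronglyMeasurable_reducedStrategy hc t).const_mul _
  absCont := (hM.isVelocity_candidate hc).path.mono fun ω hω => hω.absCont
  initial := Eventually.of_forall fun ω => by
    rw [candidate, reducedStrategy_zero, mul_div_cancel₀ _ hc.sinh_initial]
  terminal := Eventually.of_forall fun ω => by rw [candidate, hc.sinh_terminal, zero_mul]
  energy := (lintegral_spaceTime_lt_top_iff (hM.isVelocity_candidate hc).memLp.1
    (hM.isVelocity_candidate hc).path).2 (hM.isVelocity_candidate hc).memLp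

lemma integrable_cost (hM : IsPriceModel 𝓕 P T S) (hx : IsAdmissible 𝓕 P T X x)
    (hv : IsVelocity 𝓕 P T x v) :
    Integrable (fun q : Ω × ℝ => v q.2 q.1 ^ 2 + lam * S q.2.toNNReal q.1 * x q.2 q.1 +
      ν ^ 2 * x q.2 q.1 ^ 2) (spaceTime P T) := by
  have hxm := hx.memLp hM.pos hv
  have h2 : Integrable (fun q : Ω × ℝ => lam * S q.2.toNNReal q.1 * x q.2 q.1)
      (spaceTime P T) := (hM.memLp.const_mul lam).integrable_mul hxm
  exact (hv.memLp.integrable_sq.add h2).add (hxm.integrable_sq.const_mul _)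

lemma cost_eq (hM : IsPriceModel 𝓕 P T S) (hx : IsAdmissible 𝓕 P T X x)
    (hv : IsVelocity 𝓕 P T x v) :
    HasFiniteExpectedIntegral P T (runningCost S lam ν x) ∧
      cost P T S lam ν x = ∫ q, (v q.2 q.1 ^ 2 + lam * S q.2.toNNReal q.1 * x q.2 q.1 +
        ν ^ 2 * x q.2 q.1 ^ 2) ∂spaceTime P T := by
  refine hasFiniteExpectedIntegral_of_integrable (g := fun t ω => v t ω ^ 2 +
    lam * S t.toNNReal ω * x t ω + ν ^ 2 * x t ω ^ 2) hM.pos.le (hM.integrable_cost hx hv) ?_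
  filter_upwards [hv.path] with ω hω
  filter_upwards [hω.deriv_ae_eq] with t ht
  rw [runningCost, ht]

/-- The first-order condition, integrated against an admissible perturbation `h`. -/
lemma integral_firstVariation (hM : IsPriceModel 𝓕 P T S) (hc : IsHyperbolicPair T ν σ C)
    {h w : ℝ → Ω → ℝ} (hh : MemLp (fun q : Ω × ℝ => h q.2 q.1) 2 (spaceTime P T))
    (hha : ∀ t ∈ Ioc 0 T, StronglyMeasurable[𝓕 t.toNNReal] (h t))
    (hw : IsVelocity 𝓕 P T h w) (h0 : ∀ᵐ ω ∂P, h 0 ω = 0) (hT : ∀ᵐ ω ∂P, h T ω = 0) :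
    Integrable (fun q : Ω × ℝ => 2 * candidateVelocity X lam S σ C q.2 q.1 * w q.2 q.1 +
      2 * ν ^ 2 * candidate X lam S σ C q.2 q.1 * h q.2 q.1 +
      lam * S q.2.toNNReal q.1 * h q.2 q.1) (spaceTime P T) ∧
    ∫ q, (2 * candidateVelocity X lam S σ C q.2 q.1 * w q.2 q.1 +
      2 * ν ^ 2 * candidate X lam S σ C q.2 q.1 * h q.2 q.1 +
      lam * S q.2.toNNReal q.1 * h q.2 q.1) ∂spaceTime P T = 0 := by
  -- `k = (θh)'` integrates to zero along each path, so the martingale identity gives `E∫ S k = 0`.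
  set k : ℝ → Ω → ℝ := fun t ω => halfTanh σ C t * w t ω - (1 + C t)⁻¹ * h t ω with hk
  have hkm : MemLp (fun q : Ω × ℝ => k q.2 q.1) 2 (spaceTime P T) :=
    (MemLp.continuous_mul_snd hw.memLp hc.continuous_halfTanh).sub
      (MemLp.continuous_mul_snd hh hc.continuous_inv)
  have hka : ∀ t ∈ Ioc 0 T, StronglyMeasurable[𝓕 t.toNNReal] (k t) := fun t ht =>
    ((hw.adapted t ht).const_mul _).sub ((hha t ht).const_mul _)
  have hk0 : ∀ᵐ ω ∂P, ∫ t in Ioc 0 T, k t ω = 0 := by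
    filter_upwards [hw.path, h0, hT] with ω hω hω0 hωT
    have h1 := (hc.hasACDeriv_halfTanh.mul hω).integral_eq_sub ⟨hM.pos.le, le_rfl⟩
    rw [hω0, hωT, mul_zero, mul_zero, sub_zero] at h1
    refine Eq.trans (integral_congr_ae (Eventually.of_forall fun t => ?_)) h1
    simp only [hk]
    ring
  have hSk := hM.martingale.integral_spaceTime_mul hM.memLp hM.memLp_terminal hkm hka
  rw [integral_congr_ae (g := fun _ => (0 : ℝ)) (hk0.mono fun ω hω => by simp [hω]),
    integral_zero] at hSk
  have hSki : Integrable (fun q : Ω × ℝ => S q.2.toNNReal q.1 * k q.2 q.1) (spaceTime P T) :=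
    hM.memLp.integrable_mul hkm
  have hcv := hM.isVelocity_candidate (X := X) (lam := lam) hc
  have hcm := (hM.isAdmissible_candidate (X := X) (lam := lam) hc).memLp hM.pos hcv
  have hG : Integrable (fun q : Ω × ℝ => 2 * candidateVelocity X lam S σ C q.2 q.1 * w q.2 q.1 +
      2 * ν ^ 2 * candidate X lam S σ C q.2 q.1 * h q.2 q.1 +
      lam * S q.2.toNNReal q.1 * h q.2 q.1) (spaceTime P T) :=
    (((hcv.memLp.const_mul 2).integrable_mul hw.memLp).add
      ((hcm.const_mul (2 * ν ^ 2)).integrable_mul hh)).add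
      ((hM.memLp.const_mul lam).integrable_mul hh)
  refine ⟨hG, ?_⟩
  have hGk := hG.add (hSki.const_mul lam)
  -- Adding `lam S k` cancels the term `2σA'w = -lam S θ w` and leaves `-2(CAh)'`; here `lam S h (1
  -- - 1/(1 + C)) = -2CA'h`.
  have hz : ∫ q, ((2 * candidateVelocity X lam S σ C q.2 q.1 * w q.2 q.1 +
      2 * ν ^ 2 * candidate X lam S σ C q.2 q.1 * h q.2 q.1 +
      lam * S q.2.toNNReal q.1 * h q.2 q.1) + lam * (S q.2.toNNReal q.1 * k q.2 q.1))
      ∂spaceTime P T = 0 := by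
    refine (integral_prod _ hGk).trans ?_
    rw [integral_congr_ae (g := fun _ => (0 : ℝ)) ?_, integral_zero]
    filter_upwards [hw.path, h0, hT, hM.hasACDeriv_reducedStrategy (X := X) (lam := lam) hc]
      with ω hω hω0 hωT hA
    have h1 := ((hc.hasACDeriv_cosh.mul hA).mul hω).integral_eq_sub ⟨hM.pos.le, le_rfl⟩
    rw [hω0, hωT, mul_zero, mul_zero, sub_zero] at h1
    refine Eq.trans ?_ ((congrArg (fun z => (-2 : ℝ) * z) h1).trans (mul_zero _))
    rw [← integral_const_mul]
    refine integral_congr_ae (Eventually.of_forall fun t => ?_)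
    have hne := (hc.one_add_pos t).ne'
    simp only [hk, candidateVelocity, candidate, reducedVelocity, halfTanh, Pi.add_apply]
    field_simp
    ring
  rw [integral_add hG (hSki.const_mul lam), integral_const_mul, hSk, mul_zero, add_zero] at hz
  exact hz

/-- The excess cost of an admissible strategy over the candidate. -/
lemma cost_sub_cost_candidate (hM : IsPriceModel 𝓕 P T S) (hc : IsHyperbolicPair T ν σ C)
    (hx : IsAdmissible 𝓕 P T X x) (hv : IsVelocity 𝓕 P T x v) :
    cost P T S lam ν x = cost P T S lam ν (candidate X lam S σ C) +
      ∫ q, ((v q.2 q.1 - candidateVelocity X lam S σ C q.2 q.1) ^ 2 +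
        ν ^ 2 * (x q.2 q.1 - candidate X lam S σ C q.2 q.1) ^ 2) ∂spaceTime P T := by
  have hcv := hM.isVelocity_candidate (X := X) (lam := lam) hc
  have hca := hM.isAdmissible_candidate (X := X) (lam := lam) hc
  have hh := (hx.memLp hM.pos hv).sub (hca.memLp hM.pos hcv)
  have hw := hv.memLp.sub hcv.memLp
  have hvar := hM.integral_firstVariation (X := X) (lam := lam) hc
    (h := fun t ω => x t ω - candidate X lam S σ C t ω)
    (w := fun t ω => v t ω - candidateVelocity X lam S σ C t ω) hh
    (fun t ht => (hx.measurable_of_mem (Ioc_subset_Icc_self ht)).sub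
      (hca.measurable_of_mem (Ioc_subset_Icc_self ht)))
    ⟨fun t ht => (hv.adapted t ht).sub (hcv.adapted t ht), hw,
      by filter_upwards [hv.path, hcv.path] with ω h1 h2 using h1.sub h2⟩
    (by filter_upwards [hx.initial, hca.initial] with ω h1 h2; rw [h1, h2, sub_self])
    (by filter_upwards [hx.terminal, hca.terminal] with ω h1 h2; rw [h1, h2, sub_self])
  have hq : Integrable (fun q : Ω × ℝ =>
      (v q.2 q.1 - candidateVelocity X lam S σ C q.2 q.1) ^ 2 +
        ν ^ 2 * (x q.2 q.1 - candidate X lam S σ C q.2 q.1) ^ 2) (spaceTime P T) :=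
    hw.integrable_sq.add (hh.integrable_sq.const_mul _)
  have hi := hM.integrable_cost (lam := lam) (ν := ν) hca hcv
  -- Pointwise, the cost of `x` is the cost of the candidate, plus the quadratic remainder, plus the
  -- first variation in the direction `x - x*`.
  have hsum := integral_add (hi.add hq) hvar.1
  rw [hvar.2, integral_add' hi hq, add_zero] at hsum
  rw [(hM.cost_eq hx hv).2, (hM.cost_eq hca hcv).2, ← hsum]
  refine integral_congr_ae (Eventually.of_forall fun q => ?_)
  simp only [Pi.add_apply]
  ring

lemma isUniqueMinimizer_candidate (hM : IsPriceModel 𝓕 P T S) (hc : IsHyperbolicPair T ν σ C) :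
    IsUniqueMinimizer 𝓕 P T X S lam ν (candidate X lam S σ C) := by
  have hcv := hM.isVelocity_candidate (X := X) (lam := lam) hc
  have hca := hM.isAdmissible_candidate (X := X) (lam := lam) hc
  refine ⟨hca, fun x hx => ?_, fun x hx hmin => ?_⟩
  · obtain ⟨v, hv⟩ := hx.exists_isVelocity hM.pos.le
    rw [hM.cost_sub_cost_candidate hc hx hv]
    exact le_add_of_nonneg_right (integral_nonneg fun q => by positivity)
  · obtain ⟨v, hv⟩ := hx.exists_isVelocity hM.pos.le
    have hle := hmin _ hca
    rw [hM.cost_sub_cost_candidate hc hx hv] at hle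
    have hq : Integrable (fun q : Ω × ℝ =>
        (v q.2 q.1 - candidateVelocity X lam S σ C q.2 q.1) ^ 2 +
          ν ^ 2 * (x q.2 q.1 - candidate X lam S σ C q.2 q.1) ^ 2) (spaceTime P T) :=
      (hv.memLp.sub hcv.memLp).integrable_sq.add
        (((hx.memLp hM.pos hv).sub (hca.memLp hM.pos hcv)).integrable_sq.const_mul _)
    -- The velocity square alone forces equality: the velocities agree almost everywhere, and a
    -- common initial value makes the paths agree at all times. Hence `ν = 0` needs no separate
    -- argument.
    have hz := (integral_eq_zero_iff_of_nonneg (fun q => by positivity) hq).1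
      (le_antisymm (by linarith) (integral_nonneg fun q => by positivity))
    filter_upwards [Measure.ae_ae_of_ae_prod hz, hv.path, hcv.path, hx.initial, hca.initial]
      with ω hω h1 h2 h3 h4 t ht
    have h5 := (h1.sub h2).integral_eq_sub ht
    rw [h3, h4, integral_congr_ae (g := fun _ => (0 : ℝ)), integral_zero] at h5
    · linarith
    · filter_upwards [ae_restrict_of_ae_restrict_of_subset (Ioc_subset_Ioc_right ht.2) hω]
        with s hs
      simp only [Pi.zero_apply] at hs
      have h6 := sq_nonneg (v s ω - candidateVelocity X lam S σ C s ω)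
      have h7 : 0 ≤ ν ^ 2 * (x s ω - candidate X lam S σ C s ω) ^ 2 := by positivity
      exact pow_eq_zero_iff (two_ne_zero) |>.1 (by linarith)

/-! ### The minimal value -/

lemma hasFiniteExpectedIntegral_sq (hM : IsPriceModel 𝓕 P T S) (hc : IsHyperbolicPair T ν σ C) :
    HasFiniteExpectedIntegral P T (fun t ω => (S t.toNNReal ω * halfTanh σ C t) ^ 2) ∧
      expectedIntegral P T (fun t ω => (S t.toNNReal ω * halfTanh σ C t) ^ 2) =
        ∫ q, (halfTanh σ C q.2 * S q.2.toNNReal q.1) ^ 2 ∂spaceTime P T :=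
  hasFiniteExpectedIntegral_of_integrable
    (g := fun t ω => (halfTanh σ C t * S t.toNNReal ω) ^ 2) hM.pos.le
    (MemLp.continuous_mul_snd hM.memLp hc.continuous_halfTanh).integrable_sq
    (Eventually.of_forall fun ω => Eventually.of_forall fun t => by simp only [mul_comm])

/-- The factor of `S` is `-(σθA)'`, whose integral along each path is the constant `X θ(0)` since
`σ(T) = 0` and `A(0) = X/σ(0)`. -/
lemma integral_mul_candidate (hM : IsPriceModel 𝓕 P T S) (hc : IsHyperbolicPair T ν σ C) :
    ∫ q, S q.2.toNNReal q.1 * (candidate X lam S σ C q.2 q.1 +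
      lam / 2 * (halfTanh σ C q.2 * (halfTanh σ C q.2 * S q.2.toNNReal q.1))) ∂spaceTime P T =
      X * halfTanh σ C 0 * ∫ ω, S T.toNNReal ω ∂P := by
  have hcv := hM.isVelocity_candidate (X := X) (lam := lam) hc
  have hca := hM.isAdmissible_candidate (X := X) (lam := lam) hc
  rw [hM.martingale.integral_spaceTime_mul hM.memLp hM.memLp_terminal
    (y := fun t ω => candidate X lam S σ C t ω +
      lam / 2 * (halfTanh σ C t * (halfTanh σ C t * S t.toNNReal ω)))
    ((hca.memLp hM.pos hcv).add ((MemLp.continuous_mul_snd (MemLp.continuous_mul_snd hM.memLp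
      hc.continuous_halfTanh) hc.continuous_halfTanh).const_mul _))
    (fun t ht => (hca.measurable_of_mem (Ioc_subset_Icc_self ht)).add
      ((((hM.martingale.stronglyMeasurable _).const_mul _).const_mul _).const_mul _)),
    ← integral_const_mul]
  refine integral_congr_ae ?_
  filter_upwards [hM.hasACDeriv_reducedStrategy (X := X) (lam := lam) hc] with ω hA
  have h1 := ((hc.hasACDeriv_sinh.mul hc.hasACDeriv_halfTanh).mul hA).integral_eq_sub
    ⟨hM.pos.le, le_rfl⟩
  have h2 : ∫ t in Ioc 0 T, (candidate X lam S σ C t ω +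
      lam / 2 * (halfTanh σ C t * (halfTanh σ C t * S t.toNNReal ω))) =
      X * halfTanh σ C 0 := by
    have h3 : X * halfTanh σ C 0 = (-1) * (σ T * halfTanh σ C T * reducedStrategy X lam S σ C T ω -
        σ 0 * halfTanh σ C 0 * reducedStrategy X lam S σ C 0 ω) := by
      have := hc.sinh_initial
      rw [hc.sinh_terminal, reducedStrategy_zero]
      field_simp
      ring
    rw [h3, ← h1, ← integral_const_mul]
    refine integral_congr_ae (Eventually.of_forall fun t => ?_)
    have hne := (hc.one_add_pos t).ne'
    simp only [candidate, reducedVelocity, halfTanh]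
    field_simp
    ring
  rw [h2, mul_comm]

lemma cost_candidate (hM : IsPriceModel 𝓕 P T S) (hc : IsHyperbolicPair T ν σ C) :
    cost P T S lam ν (candidate X lam S σ C) =
      C 0 / σ 0 * X ^ 2 + lam * X * halfTanh σ C 0 * ∫ ω, S T.toNNReal ω ∂P -
        lam ^ 2 / 4 *
          expectedIntegral P T (fun t ω => (S t.toNNReal ω * halfTanh σ C t) ^ 2) := by
  have hcv := hM.isVelocity_candidate (X := X) (lam := lam) hc
  have hca := hM.isAdmissible_candidate (X := X) (lam := lam) hc
  have hcm := hca.memLp hM.pos hcv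
  have hθ := MemLp.continuous_mul_snd hM.memLp hc.continuous_halfTanh
  have hI1 := hM.integrable_cost (lam := lam) (ν := ν) hca hcv
  have hI2 : Integrable (fun q : Ω × ℝ => S q.2.toNNReal q.1 * (candidate X lam S σ C q.2 q.1 +
      lam / 2 * (halfTanh σ C q.2 * (halfTanh σ C q.2 * S q.2.toNNReal q.1)))) (spaceTime P T) :=
    hM.memLp.integrable_mul (hcm.add
      ((MemLp.continuous_mul_snd hθ hc.continuous_halfTanh).const_mul _))
  have hI3 : Integrable (fun q : Ω × ℝ => (halfTanh σ C q.2 * S q.2.toNNReal q.1) ^ 2)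
      (spaceTime P T) := hθ.integrable_sq
  have hI4 := (hI1.sub (hI2.const_mul lam)).add (hI3.const_mul (lam ^ 2 / 4))
  -- Once the terms with `S` are removed this way, the integrand is `-(σCA²)'`, so only the boundary
  -- value `σ(0)C(0)(X/σ(0))²` remains.
  have hR : ∫ q, ((candidateVelocity X lam S σ C q.2 q.1 ^ 2 +
      lam * S q.2.toNNReal q.1 * candidate X lam S σ C q.2 q.1 +
      ν ^ 2 * candidate X lam S σ C q.2 q.1 ^ 2 -
      lam * (S q.2.toNNReal q.1 * (candidate X lam S σ C q.2 q.1 +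
        lam / 2 * (halfTanh σ C q.2 * (halfTanh σ C q.2 * S q.2.toNNReal q.1))))) +
      lam ^ 2 / 4 * (halfTanh σ C q.2 * S q.2.toNNReal q.1) ^ 2) ∂spaceTime P T =
      C 0 / σ 0 * X ^ 2 := by
    refine (integral_prod _ hI4).trans ?_
    rw [integral_congr_ae (g := fun _ => C 0 / σ 0 * X ^ 2) ?_]
    · simp
    filter_upwards [hM.hasACDeriv_reducedStrategy (X := X) (lam := lam) hc] with ω hA
    have h1 := ((hc.hasACDeriv_sinh.mul hc.hasACDeriv_cosh).mul (hA.mul hA)).integral_eq_sub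
      ⟨hM.pos.le, le_rfl⟩
    have h3 : C 0 / σ 0 * X ^ 2 =
        (-1) * (σ T * C T * (reducedStrategy X lam S σ C T ω * reducedStrategy X lam S σ C T ω) -
        σ 0 * C 0 * (reducedStrategy X lam S σ C 0 ω * reducedStrategy X lam S σ C 0 ω)) := by
      have := hc.sinh_initial
      rw [hc.sinh_terminal, reducedStrategy_zero]
      field_simp
      ring
    rw [h3, ← h1, ← integral_const_mul]
    refine integral_congr_ae (Eventually.of_forall fun t => ?_)
    have hne := (hc.one_add_pos t).ne'
    simp only [candidate, candidateVelocity, reducedVelocity, halfTanh, Pi.add_apply, Pi.sub_apply]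
    field_simp
    ring
  have hsum := (integral_add (hI1.sub (hI2.const_mul lam)) (hI3.const_mul (lam ^ 2 / 4))).symm.trans
    hR
  rw [integral_sub' hI1 (hI2.const_mul lam), integral_const_mul, integral_const_mul,
    hM.integral_mul_candidate hc] at hsum
  rw [(hM.cost_eq hca hcv).2, (hM.hasFiniteExpectedIntegral_sq hc).2]
  linarith

lemma integral_terminal_eq (hM : IsPriceModel 𝓕 P T S) (h0 : TrivialAtZero 𝓕 P) :
    ∀ᵐ ω ∂P, S 0 ω = ∫ ω', S T.toNNReal ω' ∂P := by
  have h1 : ∫ ω, S T.toNNReal ω ∂P = ∫ ω, S 0 ω ∂P := by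
    rw [← integral_condExp (𝓕.le 0) (f := S T.toNNReal)]
    exact integral_congr_ae (hM.martingale.condExp_ae_eq (zero_le (a := T.toNNReal)))
  rw [h1]
  exact h0.ae_eq_integral (hM.martingale.stronglyMeasurable 0) (hM.martingale.integrable 0)

end IsPriceModel

end Model

/-! ### The two concrete cases -/

lemma isHyperbolicPair_of_pos {T ν : ℝ} (hT : 0 < T) (hν : 0 < ν) :
    IsHyperbolicPair T ν (fun t => Real.sinh (ν * (T - t)) / ν)
      (fun t => Real.cosh (ν * (T - t))) where
  hasDerivAt_sinh t := by
    have h1 : HasDerivAt (fun t => ν * (T - t)) (-ν) t := by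
      simpa using ((hasDerivAt_id t).const_sub T).const_mul ν
    refine (h1.sinh.div_const ν).congr_deriv ?_
    field_simp
  hasDerivAt_cosh t := by
    have h1 : HasDerivAt (fun t => ν * (T - t)) (-ν) t := by
      simpa using ((hasDerivAt_id t).const_sub T).const_mul ν
    refine h1.cosh.congr_deriv ?_
    field_simp
  sq_sub_sq t := by
    field_simp
    exact Real.cosh_sq_sub_sinh_sq _
  one_add_pos t := by positivity
  sinh_terminal := by simp
  sinh_initial := by
    have := Real.sinh_pos_iff.2 (show 0 < ν * (T - 0) by simpa using mul_pos hν hT)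
    positivity

lemma isHyperbolicPair_zero {T : ℝ} (hT : 0 < T) :
    IsHyperbolicPair T 0 (fun t => T - t) (fun _ => 1) where
  hasDerivAt_sinh t := (hasDerivAt_id t).const_sub T
  hasDerivAt_cosh t := by simpa using hasDerivAt_const t (1 : ℝ)
  sq_sub_sq t := by simp
  one_add_pos t := by norm_num
  sinh_terminal := sub_self T
  sinh_initial := by simpa using hT.ne'

lemma tanh_half (y : ℝ) : Real.tanh (y / 2) = Real.sinh y * (1 + Real.cosh y)⁻¹ := by
  have h1 : Real.sinh y = 2 * Real.sinh (y / 2) * Real.cosh (y / 2) := by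
    rw [← Real.sinh_two_mul]; ring_nf
  have h2 : 1 + Real.cosh y = 2 * Real.cosh (y / 2) ^ 2 := by
    have h3 : Real.cosh y = Real.cosh (2 * (y / 2)) := by ring_nf
    rw [h3, Real.cosh_two_mul]
    linarith [Real.cosh_sq_sub_sinh_sq (y / 2)]
  have := (Real.cosh_pos (y / 2)).ne'
  rw [h1, h2, Real.tanh_eq_sinh_div_cosh]
  field_simp

end

lemma optimalStrategy_eq_candidate {Ω : Type*} {S : ℝ≥0 → Ω → ℝ} {T X lam ν : ℝ} (hT : 0 < T)
    (hν : 0 < ν) :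
    optimalStrategy T X S lam ν = candidate X lam S (fun t => Real.sinh (ν * (T - t)) / ν)
      (fun t => Real.cosh (ν * (T - t))) := by
  funext t ω
  have := (Real.sinh_pos_iff.2 (mul_pos hν hT)).ne'
  simp only [optimalStrategy, candidate, reducedStrategy, sub_zero, div_eq_mul_inv (S _ _)]
  field_simp

lemma optimalStrategyZero_eq_candidate {Ω : Type*} {S : ℝ≥0 → Ω → ℝ} {T X lam : ℝ}
    (hT : 0 < T) :
    optimalStrategyZero T X S lam = candidate X lam S (fun t => T - t) (fun _ => 1) := by
  funext t ω
  simp only [optimalStrategyZero, candidate, reducedStrategy, sub_zero,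
    intervalIntegral.integral_mul_const]
  field_simp
  ring

theorem theorem1 {Ω : Type*} {m : MeasurableSpace Ω} (P : Measure Ω) [IsProbabilityMeasure P]
    (𝓕 : Filtration ℝ≥0 m) (h𝓕 : UsualConditions 𝓕 P) (h𝓕0 : TrivialAtZero 𝓕 P)
    (T : ℝ) (hT : 0 < T) (X lam : ℝ)
    (S : ℝ≥0 → Ω → ℝ) (hS : Martingale S 𝓕 P) (hSrc : RightContinuousPaths P S)
    (hSsq : SquareIntegrableSup P T S) :
    -- the cost functional is well defined and finite on the class of admissible strategies
    (∀ ν : ℝ, ∀ x, IsAdmissible 𝓕 P T X x →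
      HasFiniteExpectedIntegral P T (runningCost S lam ν x)) ∧
    -- the case `ν > 0`
    (∀ ν : ℝ, 0 < ν →
      IsUniqueMinimizer 𝓕 P T X S lam ν (optimalStrategy T X S lam ν) ∧
      HasFiniteExpectedIntegral P T
        (fun t ω => (S t.toNNReal ω * Real.tanh (ν * (T - t) / 2)) ^ 2) ∧
      ∀ᵐ ω ∂P, cost P T S lam ν (optimalStrategy T X S lam ν) =
        ν * X ^ 2 * (Real.cosh (ν * T) / Real.sinh (ν * T))
          + lam * X * S 0 ω / ν * Real.tanh (ν * T / 2)
          - lam ^ 2 / (4 * ν ^ 2) * expectedIntegral P T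
              (fun t ω' => (S t.toNNReal ω' * Real.tanh (ν * (T - t) / 2)) ^ 2)) ∧
    -- the case `ν = 0`
    (IsUniqueMinimizer 𝓕 P T X S lam 0 (optimalStrategyZero T X S lam) ∧
      HasFiniteExpectedIntegral P T (fun t ω => (S t.toNNReal ω * (T - t)) ^ 2) ∧
      ∀ᵐ ω ∂P, cost P T S lam 0 (optimalStrategyZero T X S lam) =
        X ^ 2 / T + 1 / 2 * lam * X * S 0 ω * T
          - lam ^ 2 / 16 * expectedIntegral P T
              (fun t ω' => (S t.toNNReal ω' * (T - t)) ^ 2)) := by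
  have hM : IsPriceModel 𝓕 P T S := ⟨h𝓕, hT, hS, hSrc, hSsq⟩
  refine ⟨fun ν x hx => ?_, fun ν hν => ?_, ?_⟩
  · obtain ⟨v, hv⟩ := hx.exists_isVelocity hT.le
    exact (hM.cost_eq hx hv).1
  · have hc := isHyperbolicPair_of_pos hT hν
    have hsq : (fun (t : ℝ) (ω : Ω) => (S t.toNNReal ω * Real.tanh (ν * (T - t) / 2)) ^ 2) =
        fun t ω => ν ^ 2 * (S t.toNNReal ω * halfTanh (fun t => Real.sinh (ν * (T - t)) / ν)
          (fun t => Real.cosh (ν * (T - t))) t) ^ 2 := by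
      funext t ω
      rw [tanh_half, halfTanh]
      field_simp
    rw [optimalStrategy_eq_candidate hT hν, hsq]
    refine ⟨hM.isUniqueMinimizer_candidate hc,
      (hM.hasFiniteExpectedIntegral_sq hc).1.const_mul _, ?_⟩
    filter_upwards [hM.integral_terminal_eq h𝓕0] with ω hω
    rw [hM.cost_candidate hc, hω, expectedIntegral_const_mul, tanh_half]
    simp only [sub_zero, halfTanh]
    field_simp
  · have hc := isHyperbolicPair_zero hT
    -- Here `θ = (T - t)/2`; the factor `4` turns `lam²/4` into `lam²/16`.
    have hsq : (fun (t : ℝ) (ω : Ω) => (S t.toNNReal ω * (T - t)) ^ 2) =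
        fun t ω => 4 * (S t.toNNReal ω * halfTanh (fun t => T - t) (fun _ => 1) t) ^ 2 := by
      funext t ω
      rw [halfTanh]
      ring
    rw [optimalStrategyZero_eq_candidate hT, hsq]
    refine ⟨hM.isUniqueMinimizer_candidate hc,
      (hM.hasFiniteExpectedIntegral_sq hc).1.const_mul _, ?_⟩
    filter_upwards [hM.integral_terminal_eq h𝓕0] with ω hω
    rw [hM.cost_candidate hc, hω, expectedIntegral_const_mul]
    simp only [sub_zero, halfTanh]
    ring
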